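/- Let $\mathcal V$ be a finite set of graph nodes, $N=|\mathcal V|$, let $A\in\mathbb R^{N\times N}$ be any matrix (the adjacency matrix of a graph on $\mathcal V$ or any modified or normalized version of it), and let $\phi(t)=\max(t,0)$ be the ReLU function. Let $x^{(0)}(x)\in\mathbb R^{d_0}$, $x\in\mathcal V$, be fixed input feature vectors. The $L$-layer graph convolutional network (GCN) with layer widths $d_1,\dots,d_L\ge 1$ is defined for $l=1,\dots,L$ by \[ y_i^{(l)}(x)=\sum_{j=1}^{d_{l-1}}W^{(l)}_{ji}x_j^{(l-1)}(x),\qquad z_i^{(l)}(x)=b_i^{(l)}+\sum_{v\in\mathcal V}A_{xv}\,y_i^{(l)}(v),\qquad x_i^{(l)}(x)=\phi\bigl(z_i^{(l)}(x)\bigr). \] For each choice of widths let all biases and weights be independent with distributions $b_i^{(l)}\sim\mathcal N(0,\sigma_b^2)$ and $W_{ji}^{(l)}\sim\mathcal N(0,\sigma_w^2/d_{l-1})$, where $\sigma_b,\sigma_w\ge 0$. Let $C^{(0)}(x,x')=\frac1{d_0}\,x^{(0)}(x)\cdot x^{(0)}(x')$ (read as $0$ if $d_0=0$) and define matrices recursively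 by \[ K^{(l+1)}=\sigma_b^2\,\mathbf 1_{N\times N}+\sigma_w^2\,A\,C^{(l)}A^T\quad(l=0,\dots,L-1),\qquad C^{(l)}=\mathbb E_{z\sim\mathcal N(0,K^{(l)})}\bigl[\phi(z)\phi(z)^T\bigr]\quad(l=1,\dots,L), \] where $\mathbf 1_{N\times N}$ is the all-ones matrix. Then for every $l=1,\dots,L$ the matrix $K^{(l)}$ is positive semi-definite, and for every coordinate index $i$ (with $i\le d_l$), as $d_1,\dots,d_{L-1}$ tend to infinity in succession (first $d_1\to\infty$ with the other widths fixed, then $d_2\to\infty$, and so on up to $d_{L-1}$), the law of the random vector $\bigl(z_i^{(l)}(x)\bigr)_{x\in\mathcal V}$ converges weakly to $\mathcal N(0,K^{(l)})$; that is, all inner limits exist and the iterated weak limit of these laws is $\mathcal N(0,K^{(l)})$. -/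

import Mathlib

open MeasureTheory ProbabilityTheory Filter Topology
open scoped NNReal

noncomputable section

/-- The ReLU activation function. -/
def relu (t : ℝ) : ℝ := max t 0

/-- The widths of all layers: layer `0` is the input layer, of width `d₀`, and layer `l ≥ 1` has
width `d l` (the value `d 0` plays no role). -/
def layerWidth (d₀ : ℕ) (d : ℕ → ℕ) : ℕ → ℕ
  | 0 => d₀
  | l + 1 => d (l + 1)

/-- One graph convolution without activation:
`z_i(x) = b_i + ∑_v A_{xv} y_i(v)` with `y_i(v) = ∑_j W_{ji} x_j(v)`. -/
def graphConv {V : Type*} [Fintype V] {m n : ℕ} (A : Matrix V V ℝ)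
    (W : Matrix (Fin m) (Fin n) ℝ) (b : Fin n → ℝ) (X : Matrix V (Fin m) ℝ) :
    Matrix V (Fin n) ℝ :=
  Matrix.of fun x i => b i + ∑ v, A x v * ∑ j, W j i * X v j

/-- The post-activation values of the GCN with input features `X₀`: `gcnPost … l` is `X^{(l)}`,
with `X^{(0)} = X₀`. The parameters of layer `l + 1` are `W l` and `b l`. -/
def gcnPost {V : Type*} [Fintype V] {d₀ : ℕ} {d : ℕ → ℕ} (A : Matrix V V ℝ)
    (X₀ : Matrix V (Fin d₀) ℝ)
    (W : ∀ l : ℕ, Matrix (Fin (layerWidth d₀ d l)) (Fin (layerWidth d₀ d (l + 1))) ℝ)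
    (b : ∀ l : ℕ, Fin (layerWidth d₀ d (l + 1)) → ℝ) :
    ∀ l : ℕ, Matrix V (Fin (layerWidth d₀ d l)) ℝ
  | 0 => X₀
  | l + 1 => (graphConv A (W l) (b l) (gcnPost A X₀ W b l)).map relu

/-- The pre-activation values of the GCN: `gcnPre … l` is `z^{(l+1)}`, that is, its entry at
`x`, `i` is the `i`-th coordinate at the node `x` in layer `l + 1`. -/
def gcnPre {V : Type*} [Fintype V] {d₀ : ℕ} {d : ℕ → ℕ} (A : Matrix V V ℝ)
    (X₀ : Matrix V (Fin d₀) ℝ)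
    (W : ∀ l : ℕ, Matrix (Fin (layerWidth d₀ d l)) (Fin (layerWidth d₀ d (l + 1))) ℝ)
    (b : ∀ l : ℕ, Fin (layerWidth d₀ d (l + 1)) → ℝ) (l : ℕ) :
    Matrix V (Fin (layerWidth d₀ d (l + 1))) ℝ :=
  graphConv A (W l) (b l) (gcnPost A X₀ W b l)

/-- The index set of all scalar parameters of the layers `1, …, L`: for each layer the entries of
the weight matrix and those of the bias vector. -/
abbrev GCNParamIndex (d₀ : ℕ) (d : ℕ → ℕ) (L : ℕ) : Type :=
  Σ l : Fin L, (Fin (layerWidth d₀ d l) × Fin (layerWidth d₀ d (l + 1))) ⊕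
    Fin (layerWidth d₀ d (l + 1))

/-- The random weights `W` and biases `b` of the layers `1, …, L` are independent,
`b_i^{(l)} ∼ N(0, σ_b²)` and `W_{ji}^{(l)} ∼ N(0, σ_w² / d_{l-1})`. -/
structure IsGCNPrior {Ω : Type*} [MeasurableSpace Ω] (P : Measure Ω) (d₀ : ℕ) (d : ℕ → ℕ) (L : ℕ)
    (σb σw : ℝ≥0)
    (W : Ω → ∀ l : ℕ, Matrix (Fin (layerWidth d₀ d l)) (Fin (layerWidth d₀ d (l + 1))) ℝ)
    (b : Ω → ∀ l : ℕ, Fin (layerWidth d₀ d (l + 1)) → ℝ) : Prop where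
  law_bias : ∀ l < L, ∀ i, HasLaw (fun ω => b ω l i) (gaussianReal 0 (σb ^ 2)) P
  law_weight : ∀ l < L, ∀ j i,
    HasLaw (fun ω => W ω l j i) (gaussianReal 0 (σw ^ 2 / (layerWidth d₀ d l : ℝ≥0))) P
  indep : iIndepFun (fun (p : GCNParamIndex d₀ d L) (ω : Ω) =>
    Sum.elim (fun e => W ω p.1 e.1 e.2) (fun i => b ω p.1 i) p.2) P

/-- Convergence in distribution as `d 1, …, d n` tend to infinity *in succession*: for a family
`F d` of laws, given for the width sequences `d` in `D`, the iterated weak limit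
`lim_{d n → ∞} ⋯ lim_{d 2 → ∞} lim_{d 1 → ∞} F d` exists (every inner limit included) and
equals `μ`. Here `G k d` is the law that results after the limits in `d 1, …, d k`, the other
widths being those of `d`. -/
def TendstoInSuccession {E : Type*} [TopologicalSpace E] [MeasurableSpace E]
    [OpensMeasurableSpace E] (D : Set (ℕ → ℕ)) (n : ℕ) (F : ∀ d ∈ D, Measure E)
    (μ : Measure E) : Prop :=
  ∃ G : ℕ → (ℕ → ℕ) → ProbabilityMeasure E,
    (∀ (d : ℕ → ℕ) (hd : d ∈ D), (G 0 d : Measure E) = F d hd) ∧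
    (∀ k < n, ∀ d ∈ D,
      Tendsto (fun m : ℕ => G k (Function.update d (k + 1) m)) atTop (𝓝 (G (k + 1) d))) ∧
    ∀ d ∈ D, (G n d : Measure E) = μ

end

/-!
# Gaussian limit of wide graph convolutional networks

Condition on the post-activations `X` of a layer of width `m`. The pre-activations of the next layer
are then independent across neurons, each one distributed as `N(0, σ_b² 1 + σ_w² A S Aᵀ)` with
`S = X Xᵀ / m` (`map_convLinear_pi_gaussianReal`). The features thus enter only through their
normalized Gram matrix, and the Gram matrices of successive layers form a Markov chain on the
positive semi-definite matrices.

This chain is realized for all widths at once on one probability space: each layer has an infinite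
sequence of independent standard Gaussian vectors, and a layer of width `n` applies the square root of
its covariance to the first `n` of them (`gaussianLayer`). At each layer the network and this chain
have the same
law, by induction on the layers (`map_featureGram_paramPost`, `IsGCNPrior.map_gcnPre`): at each layer,
the fresh parameters are independent of the past (`indepFun_of_measurable_iSup`), which is all the
comparison `map_eq_map_of_indepFun` uses.

On the common space the successive limits are almost sure limits. When the widths of the first `k`
layers have already gone to infinity, the Gram matrix entering layer `k + 1` is deterministic, so
that the Gram matrix leaving it converges by the strong law of large numbers as its width tends to
infinity (`ae_tendsto_sampleGram`). The later layers, whose widths are fixed, are continuous in this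
matrix for each value of the noise, because the square root is continuous on positive semi-definite
matrices (`continuous_gaussianNode`). Almost sure convergence gives convergence in law
(`tendsto_partialLimitLaw`). After all the limits, only the last Gaussian sample with deterministic
covariance `K^{(l+1)}` remains (`partialLimitLaw_of_le`).
-/

noncomputable section

/-! ### Gram matrices and the conditional law of a layer -/

section LayerLaw

variable {V : Type*} [Fintype V]

instance instMeasurableSpaceRealMatrix {m n : Type*} : MeasurableSpace (Matrix m n ℝ) :=
  inferInstanceAs (MeasurableSpace (m → n → ℝ))

instance instBorelSpaceRealMatrix {m n : Type*} [Countable m] [Countable n] :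
    BorelSpace (Matrix m n ℝ) :=
  inferInstanceAs (BorelSpace (m → n → ℝ))

instance instSecondCountableRealMatrix {m n : Type*} [Countable m] [Countable n] :
    SecondCountableTopology (Matrix m n ℝ) :=
  inferInstanceAs (SecondCountableTopology (m → n → ℝ))

/-- Positive semi-definite real matrices as a subtype. This is the state space of the layer-to-layer
Markov chain; on it the matrix square root is continuous, with no junk values to discard. -/
abbrev PSDMatrix (V : Type*) [Fintype V] : Type _ := {S : Matrix V V ℝ // S.PosSemidef}

/-- The covariance `σ_b² 1 + σ_w² A S Aᵀ` of the next pre-activation of one neuron, when the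
current post-activations have normalized Gram matrix `S`. -/
def convCov (A : Matrix V V ℝ) (σb σw : ℝ≥0) (S : Matrix V V ℝ) : Matrix V V ℝ :=
  (σb : ℝ) ^ 2 • (Matrix.of fun _ _ => (1 : ℝ)) + (σw : ℝ) ^ 2 • (A * S * A.transpose)

lemma posSemidef_allOnes : (Matrix.of fun _ _ : V => (1 : ℝ)).PosSemidef := by
  convert Matrix.posSemidef_vecMulVec_self_star (fun _ : V => (1 : ℝ)) using 1
  ext; simp [Matrix.vecMulVec_apply]

lemma posSemidef_convCov (A : Matrix V V ℝ) (σb σw : ℝ≥0) {S : Matrix V V ℝ}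
    (hS : S.PosSemidef) : (convCov A σb σw S).PosSemidef := by
  have h := hS.mul_mul_conjTranspose_same A
  rw [Matrix.conjTranspose_eq_transpose_of_trivial] at h
  exact (posSemidef_allOnes.smul (sq_nonneg _)).add (h.smul (sq_nonneg _))

lemma continuous_convCov (A : Matrix V V ℝ) (σb σw : ℝ≥0) : Continuous (convCov A σb σw) := by
  unfold convCov; fun_prop

/-- The normalized Gram matrix `X Xᵀ / m` of `m` features per node; it is `0` for `m = 0`, in
agreement with the convention for `C 0`. -/
def featureGram {m : ℕ} (X : Matrix V (Fin m) ℝ) : PSDMatrix V :=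
  ⟨(m : ℝ)⁻¹ • (X * X.transpose), by
    have h := Matrix.posSemidef_self_mul_conjTranspose X
    rw [Matrix.conjTranspose_eq_transpose_of_trivial] at h
    exact h.smul (by positivity)⟩

lemma featureGram_apply {m : ℕ} (X : Matrix V (Fin m) ℝ) (x x' : V) :
    (featureGram X).1 x x' = (∑ j, X x j * X x' j) / m := by
  simp [featureGram, Matrix.mul_apply, div_eq_inv_mul]

lemma continuous_featureGram {m : ℕ} :
    Continuous (featureGram : Matrix V (Fin m) ℝ → PSDMatrix V) := by
  unfold featureGram; fun_prop

/-- For fixed input features `X`, the pre-activations of a layer as a linear function of its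
parameters: `.inl (j, i)` indexes the weight `W j i` and `.inr i` the bias `b i`. The result is
grouped by neuron, each neuron being a vector over the nodes. -/
def convLinear {m n : ℕ} (A : Matrix V V ℝ) (X : Matrix V (Fin m) ℝ) :
    ((Fin m × Fin n) ⊕ Fin n → ℝ) →L[ℝ] (Fin n → EuclideanSpace ℝ V) :=
  LinearMap.toContinuousLinearMap
    { toFun := fun θ i => WithLp.toLp 2 fun x =>
        graphConv A (Matrix.of fun j i => θ (.inl (j, i))) (fun i => θ (.inr i)) X x i
      map_add' := fun θ θ' => by
        ext i x
        simp [graphConv, add_mul, Finset.sum_add_distrib, mul_add]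
        ring
      map_smul' := fun c θ => by
        ext i x
        simp [graphConv, mul_add, mul_assoc, Finset.mul_sum, mul_left_comm] }

lemma convLinear_apply {m n : ℕ} (A : Matrix V V ℝ) (X : Matrix V (Fin m) ℝ)
    (θ : (Fin m × Fin n) ⊕ Fin n → ℝ) (i : Fin n) (x : V) :
    convLinear A X θ i x =
      graphConv A (Matrix.of fun j i => θ (.inl (j, i))) (fun i => θ (.inr i)) X x i := rfl

lemma convLinear_single_weight {m n : ℕ} (A : Matrix V V ℝ) (X : Matrix V (Fin m) ℝ) (j : Fin m)
    (i : Fin n) : convLinear A X (Pi.single (.inl (j, i)) 1) =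
      Pi.single i (WithLp.toLp 2 fun x => (A * X) x j) := by
  ext i' x
  rw [convLinear_apply]
  by_cases h : i' = i
  · subst h
    simp [graphConv, Pi.single_apply, Matrix.mul_apply]
  · simp [graphConv, Pi.single_apply, h]

lemma convLinear_single_bias {m n : ℕ} (A : Matrix V V ℝ) (X : Matrix V (Fin m) ℝ)
    (i : Fin n) : convLinear A X (Pi.single (.inr i) 1) =
      Pi.single i (WithLp.toLp 2 fun _ => 1) := by
  ext i' x
  rw [convLinear_apply]
  by_cases h : i' = i
  · subst h
    simp [graphConv, Pi.single_apply]
  · simp [graphConv, Pi.single_apply, h]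

lemma dotProduct_convCov_featureGram {m : ℕ} (A : Matrix V V ℝ) (σb σw : ℝ≥0)
    (X : Matrix V (Fin m) ℝ) (t : V → ℝ) :
    t ⬝ᵥ (convCov A σb σw (featureGram X).1).mulVec t =
      ∑ j, (σw : ℝ) ^ 2 / m * (∑ x, t x * (A * X) x j) ^ 2 + (σb : ℝ) ^ 2 * (∑ x, t x) ^ 2 := by
  have h : A * (featureGram X).1 * A.transpose =
      (m : ℝ)⁻¹ • ((A * X) * (A * X).transpose) := by
    simp [featureGram, Matrix.transpose_mul, Matrix.mul_assoc]
  have h1 : t ⬝ᵥ (Matrix.of fun _ _ : V => (1 : ℝ)).mulVec t = (∑ x, t x) ^ 2 := by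
    simp [dotProduct, Matrix.mulVec, ← Finset.sum_mul, sq]
  have h2 : t ⬝ᵥ ((A * X) * (A * X).transpose).mulVec t =
      ∑ j, (∑ x, t x * (A * X) x j) ^ 2 := by
    rw [← Matrix.mulVec_mulVec, Matrix.dotProduct_mulVec, Matrix.mulVec_transpose]
    simp [dotProduct, Matrix.vecMul, sq]
  rw [convCov, h, Matrix.add_mulVec, dotProduct_add, Matrix.smul_mulVec, Matrix.smul_mulVec,
    Matrix.smul_mulVec, dotProduct_smul, dotProduct_smul, dotProduct_smul, h1, h2,
    ← Finset.mul_sum]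
  simp only [smul_eq_mul]
  ring

lemma charFunDual_gaussianReal_zero (v : ℝ≥0) (ℓ : StrongDual ℝ ℝ) :
    charFunDual (gaussianReal 0 v) ℓ = Complex.exp ((-(v * (ℓ 1) ^ 2) / 2 : ℝ)) := by
  have h : ∀ y : ℝ, ℓ y = y * ℓ 1 := fun y => by
    rw [← smul_eq_mul, ← map_smul, smul_eq_mul, mul_one]
  have h2 : charFunDual (gaussianReal 0 v) ℓ = charFun (gaussianReal 0 v) (ℓ 1) := by
    rw [charFunDual_apply, charFun_apply]
    congr 1 with y
    rw [h y]; simp [mul_comm]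
  rw [h2, charFun_gaussianReal]
  congr 1; push_cast; ring

variable [DecidableEq V]

/-- Given the input features, the neurons of a layer are independent centred Gaussian vectors
whose covariance depends on the features only through their Gram matrix. Both sides are compared
through their characteristic functions. -/
lemma map_convLinear_pi_gaussianReal {m n : ℕ} (A : Matrix V V ℝ) (σb σw : ℝ≥0)
    (X : Matrix V (Fin m) ℝ) :
    (Measure.pi (Sum.elim (fun _ : Fin m × Fin n => gaussianReal 0 (σw ^ 2 / (m : ℝ≥0)))
      (fun _ : Fin n => gaussianReal 0 (σb ^ 2)))).map (convLinear A X) =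
    Measure.pi fun _ : Fin n => multivariateGaussian 0 (convCov A σb σw (featureGram X).1) := by
  have : ∀ p, IsProbabilityMeasure
      ((Sum.elim (fun _ : Fin m × Fin n => gaussianReal 0 (σw ^ 2 / (m : ℝ≥0)))
      (fun _ : Fin n => gaussianReal 0 (σb ^ 2))) p) := by
    rintro (p | p) <;> simp <;> infer_instance
  have : IsProbabilityMeasure ((Measure.pi (Sum.elim (fun _ : Fin m × Fin n =>
      gaussianReal 0 (σw ^ 2 / (m : ℝ≥0)))
      (fun _ : Fin n => gaussianReal 0 (σb ^ 2)))).map (convLinear A X)) :=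
    Measure.isProbabilityMeasure_map (by fun_prop)
  rw [← charFunDual_eq_pi_iff]
  intro L
  rw [charFunDual_map, charFunDual_pi, Fintype.prod_sum_type, Fintype.prod_prod_type_right,
    ← Finset.prod_mul_distrib]
  refine Finset.prod_congr rfl fun i _ => ?_
  -- the restriction of the functional `L` to neuron `i` is represented by the vector `t`
  set t := (InnerProductSpace.toDual ℝ (EuclideanSpace ℝ V)).symm
    (L ∘SL ContinuousLinearMap.single ℝ (fun _ : Fin n => EuclideanSpace ℝ V) i) with ht
  have hL : ∀ y : EuclideanSpace ℝ V, L (Pi.single i y) = ∑ x, t x * y x := fun y => by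
    have : L (Pi.single i y) = inner ℝ t y := by
      rw [ht, InnerProductSpace.toDual_symm_apply]; simp
    rw [this, PiLp.inner_apply]
    simp [mul_comm]
  rw [← charFun_toDual_symm_eq_charFunDual
    (L ∘SL ContinuousLinearMap.single ℝ (fun _ : Fin n => EuclideanSpace ℝ V) i), ← ht,
    charFun_multivariateGaussian (posSemidef_convCov A σb σw (featureGram X).2), dotProduct_convCov_featureGram]
  simp only [Sum.elim_inl, Sum.elim_inr, charFunDual_gaussianReal_zero, ← Complex.exp_sum,
    ← Complex.exp_add, inner_zero_right]
  simp only [ContinuousLinearMap.comp_apply, ContinuousLinearMap.single_apply,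
    convLinear_single_weight, convLinear_single_bias, hL]
  congr 1
  push_cast
  rw [← Finset.sum_div]
  simp
  ring

end LayerLaw

/-! ### Gaussian layers driven by standard noise -/

section GaussianLayer

variable {V : Type*} [Fintype V]

lemma continuous_relu : Continuous relu := continuous_id.max continuous_const

lemma abs_relu_le (t : ℝ) : |relu t| ≤ |t| := by
  unfold relu
  rcases le_total t 0 with h | h
  · simp [h]
  · simp [h]

/-- The Gram matrix of the post-activations, as a function of the pre-activations. -/
def reluGram {n : ℕ} (z : Fin n → EuclideanSpace ℝ V) : PSDMatrix V :=
  featureGram (Matrix.of fun x i => relu (z i x))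

lemma continuous_reluGram {n : ℕ} :
    Continuous (reluGram : (Fin n → EuclideanSpace ℝ V) → PSDMatrix V) := by
  refine continuous_featureGram.comp (continuous_matrix fun x i => ?_)
  exact continuous_relu.comp (by fun_prop)

/-- The noise driving one layer: independent standard Gaussian vectors. -/
def layerNoise (V : Type*) [Fintype V] : Measure (ℕ → EuclideanSpace ℝ V) :=
  Measure.infinitePi fun _ => stdGaussian (EuclideanSpace ℝ V)

instance instIsProbabilityMeasureLayerNoise : IsProbabilityMeasure (layerNoise V) := by
  unfold layerNoise; infer_instance

lemma measurePreserving_eval_layerNoise (i : ℕ) :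
    MeasurePreserving (fun g : ℕ → EuclideanSpace ℝ V => g i) (layerNoise V)
      (stdGaussian (EuclideanSpace ℝ V)) :=
  measurePreserving_eval_infinitePi (fun _ : ℕ => stdGaussian (EuclideanSpace ℝ V)) i

open scoped MatrixOrder

open scoped Matrix.Norms.L2Operator in
lemma continuous_sqrt_psdMatrix [DecidableEq V] :
    Continuous fun S : PSDMatrix V => CFC.sqrt S.1 :=
  (CFC.continuousOn_sqrt (A := Matrix V V ℝ)).comp_continuous continuous_subtype_val
    fun S => S.2.nonneg

variable [DecidableEq V]

/-- A sample of `N(0, convCov S)` driven by a standard Gaussian vector `g`. -/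
def gaussianNode (A : Matrix V V ℝ) (σb σw : ℝ≥0) (S : PSDMatrix V) (g : EuclideanSpace ℝ V) :
    EuclideanSpace ℝ V :=
  Matrix.toEuclideanCLM (𝕜 := ℝ) (CFC.sqrt (convCov A σb σw S.1)) g

lemma continuous_gaussianNode (A : Matrix V V ℝ) (σb σw : ℝ≥0) :
    Continuous fun p : PSDMatrix V × EuclideanSpace ℝ V => gaussianNode A σb σw p.1 p.2 := by
  have h : Continuous fun S : PSDMatrix V => CFC.sqrt (convCov A σb σw S.1) :=
    continuous_sqrt_psdMatrix.comp (((continuous_convCov A σb σw).comp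
      continuous_subtype_val).subtype_mk fun S => posSemidef_convCov A σb σw S.2)
  have : (fun p : PSDMatrix V × EuclideanSpace ℝ V => gaussianNode A σb σw p.1 p.2) =
      fun p => WithLp.toLp 2 ((CFC.sqrt (convCov A σb σw p.1.1)).mulVec p.2.ofLp) := by
    ext p x
    simp [gaussianNode]
  rw [this]
  exact (PiLp.continuous_toLp 2 _).comp
    ((h.comp continuous_fst).matrix_mulVec ((PiLp.continuous_ofLp 2 _).comp continuous_snd))

lemma map_gaussianNode (A : Matrix V V ℝ) (σb σw : ℝ≥0) (S : PSDMatrix V) :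
    (stdGaussian (EuclideanSpace ℝ V)).map (gaussianNode A σb σw S) =
      multivariateGaussian 0 (convCov A σb σw S.1) := by
  simp only [multivariateGaussian, zero_add]
  rfl

lemma measurable_gaussianNode (A : Matrix V V ℝ) (σb σw : ℝ≥0) (S : PSDMatrix V) :
    Measurable (gaussianNode A σb σw S) :=
  ((continuous_gaussianNode A σb σw).comp (Continuous.prodMk_right S)).measurable

/-- The pre-activations of a layer of `n` neurons with incoming Gram matrix `S`, driven by the first
`n` entries of an infinite noise sequence. The noise does not depend on `n`, so that layers of all
widths live on one probability space. -/
def gaussianLayer (A : Matrix V V ℝ) (σb σw : ℝ≥0) (n : ℕ) (S : PSDMatrix V)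
    (g : ℕ → EuclideanSpace ℝ V) : Fin n → EuclideanSpace ℝ V :=
  fun i => gaussianNode A σb σw S (g i)

lemma continuous_gaussianLayer (A : Matrix V V ℝ) (σb σw : ℝ≥0) (n : ℕ) :
    Continuous fun p : PSDMatrix V × (ℕ → EuclideanSpace ℝ V) =>
      gaussianLayer A σb σw n p.1 p.2 :=
  continuous_pi fun i => by
    have h : Continuous fun p : PSDMatrix V × (ℕ → EuclideanSpace ℝ V) => (p.1, p.2 i) := by
      fun_prop
    have h' := (continuous_gaussianNode A σb σw).comp h
    simp only [Function.comp_def] at h'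
    exact h'

/-- The Gram matrix produced by a layer of `n` Gaussian neurons with incoming Gram matrix `S`. -/
def sampleGram (A : Matrix V V ℝ) (σb σw : ℝ≥0) (n : ℕ) (S : PSDMatrix V)
    (g : ℕ → EuclideanSpace ℝ V) : PSDMatrix V :=
  reluGram (gaussianLayer A σb σw n S g)

lemma continuous_sampleGram (A : Matrix V V ℝ) (σb σw : ℝ≥0) (n : ℕ) :
    Continuous fun p : PSDMatrix V × (ℕ → EuclideanSpace ℝ V) =>
      sampleGram A σb σw n p.1 p.2 :=
  continuous_reluGram.comp (continuous_gaussianLayer A σb σw n)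

lemma measurable_sampleGram {Ω : Type*} {mΩ : MeasurableSpace Ω} (A : Matrix V V ℝ)
    (σb σw : ℝ≥0) (n : ℕ) {S : Ω → PSDMatrix V} {g : Ω → ℕ → EuclideanSpace ℝ V}
    (hS : Measurable S) (hg : Measurable g) :
    Measurable fun ω => sampleGram A σb σw n (S ω) (g ω) := by
  have h := (continuous_sampleGram A σb σw n).measurable.comp (hS.prodMk hg)
  exact h

lemma integrable_relu_mul_relu (K : Matrix V V ℝ) (x x' : V) :
    Integrable (fun z : EuclideanSpace ℝ V => relu (z x) * relu (z x'))
      (multivariateGaussian 0 K) := by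
  have h : ∀ y : V, MemLp (fun z : EuclideanSpace ℝ V => relu (z y)) 2
      (multivariateGaussian 0 K) := fun y => by
    have h1 : MemLp (fun z : EuclideanSpace ℝ V => z) 2 (multivariateGaussian 0 K) :=
      IsGaussian.memLp_two_id
    refine h1.mono (continuous_relu.comp (by fun_prop)).aestronglyMeasurable
      (Eventually.of_forall fun z => ?_)
    exact (abs_relu_le _).trans (PiLp.norm_apply_le z y)
  exact (h x).integrable_mul (h x')

/-- The infinite-width limit of `sampleGram`: the matrix `𝔼 [φ(z) φ(z)ᵀ]` for
`z ∼ N(0, convCov S)`. -/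
def limitGram (A : Matrix V V ℝ) (σb σw : ℝ≥0) (S : PSDMatrix V) : PSDMatrix V :=
  ⟨Matrix.of fun x x' => ∫ z : EuclideanSpace ℝ V, relu (z x) * relu (z x')
    ∂(multivariateGaussian 0 (convCov A σb σw S.1)), by
    refine .of_dotProduct_mulVec_nonneg ?_ fun t => ?_
    · ext x x'
      simp [mul_comm]
    -- `tᵀ 𝔼[φ(z) φ(z)ᵀ] t = 𝔼[(t · φ(z))²]`
    · have h : star t ⬝ᵥ (Matrix.of fun x x' => ∫ z : EuclideanSpace ℝ V, relu (z x) * relu (z x')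
          ∂(multivariateGaussian 0 (convCov A σb σw S.1))).mulVec t =
          ∫ z : EuclideanSpace ℝ V, (∑ x, t x * relu (z x)) ^ 2
            ∂(multivariateGaussian 0 (convCov A σb σw S.1)) := by
        have h1 : ∀ z : EuclideanSpace ℝ V, (∑ x, t x * relu (z x)) ^ 2 =
            ∑ x, ∑ x', (t x * t x') * (relu (z x) * relu (z x')) := fun z => by
          rw [sq, Finset.sum_mul_sum]
          exact Finset.sum_congr rfl fun x _ => Finset.sum_congr rfl fun x' _ => by ring
        simp_rw [h1]
        rw [integral_finsetSum _ fun x _ => integrable_finsetSum _ fun x' _ =>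
          (integrable_relu_mul_relu _ x x').const_mul _]
        simp only [dotProduct, Matrix.mulVec, Finset.mul_sum]
        refine Finset.sum_congr rfl fun x _ => ?_
        rw [integral_finsetSum _ fun x' _ => (integrable_relu_mul_relu _ x x').const_mul _]
        refine Finset.sum_congr rfl fun x' _ => ?_
        rw [integral_const_mul]
        simp
        ring
      rw [h]
      exact integral_nonneg fun z => sq_nonneg _⟩

lemma map_gaussianNode_eval (A : Matrix V V ℝ) (σb σw : ℝ≥0) (S : PSDMatrix V) (i : ℕ) :
    (layerNoise V).map (fun g => gaussianNode A σb σw S (g i)) =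
      multivariateGaussian 0 (convCov A σb σw S.1) := by
  rw [← map_gaussianNode, ← (measurePreserving_eval_layerNoise i).map_eq,
    Measure.map_map (measurable_gaussianNode A σb σw S)
      (measurePreserving_eval_layerNoise i).measurable]
  rfl

/-- The samples of `gaussianLayer` have the conditional law of a layer of the random network found in
`map_convLinear_pi_gaussianReal`. -/
lemma map_gaussianLayer (A : Matrix V V ℝ) (σb σw : ℝ≥0) (n : ℕ) (S : PSDMatrix V) :
    (layerNoise V).map (gaussianLayer A σb σw n S) =
      Measure.pi fun _ : Fin n => multivariateGaussian 0 (convCov A σb σw S.1) := by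
  have hm := measurable_gaussianNode A σb σw S
  have hmi : ∀ i : ℕ, Measurable fun g : ℕ → EuclideanSpace ℝ V => gaussianNode A σb σw S (g i) :=
    fun i => hm.comp (measurable_pi_apply i)
  have h1 : iIndepFun (fun (i : ℕ) (g : ℕ → EuclideanSpace ℝ V) => gaussianNode A σb σw S (g i))
      (layerNoise V) := iIndepFun_infinitePi (fun _ => hm)
  have h2 := h1.precomp (Fin.val_injective (n := n))
  have h3 := (iIndepFun_iff_map_fun_eq_pi_map (fun i : Fin n => (hmi i).aemeasurable)).1 h2
  refine h3.trans ?_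
  congr 1 with i : 1
  exact map_gaussianNode_eval A σb σw S i

/-- The strong law of large numbers, entry by entry, for a layer whose width tends to infinity. -/
lemma ae_tendsto_sampleGram (A : Matrix V V ℝ) (σb σw : ℝ≥0) (S : PSDMatrix V) :
    ∀ᵐ g ∂(layerNoise V), Tendsto (fun m : ℕ => sampleGram A σb σw m S g) atTop
      (𝓝 (limitGram A σb σw S)) := by
  have hm := measurable_gaussianNode A σb σw S
  have hmi : ∀ i : ℕ, Measurable fun g : ℕ → EuclideanSpace ℝ V => gaussianNode A σb σw S (g i) :=
    fun i => hm.comp (measurable_pi_apply i)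
  have key : ∀ x x' : V, ∀ᵐ g ∂(layerNoise V), Tendsto (fun m : ℕ =>
      (sampleGram A σb σw m S g).1 x x') atTop
      (𝓝 ((limitGram A σb σw S).1 x x')) := fun x x' => by
    set f : EuclideanSpace ℝ V → ℝ := fun z => relu (z x) * relu (z x') with hf
    have hfc : Continuous f := (continuous_relu.comp (by fun_prop)).mul
      (continuous_relu.comp (by fun_prop))
    have hfm : Measurable fun g => f (gaussianNode A σb σw S g) := hfc.measurable.comp hm
    have hmap := map_gaussianNode_eval A σb σw S
    have hind : iIndepFun (fun (i : ℕ) (g : ℕ → EuclideanSpace ℝ V) =>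
        f (gaussianNode A σb σw S (g i))) (layerNoise V) := iIndepFun_infinitePi (fun _ => hfm)
    have hident : ∀ i, IdentDistrib (fun g : ℕ → EuclideanSpace ℝ V =>
        f (gaussianNode A σb σw S (g i))) (fun g => f (gaussianNode A σb σw S (g 0)))
        (layerNoise V) (layerNoise V) := fun i =>
      IdentDistrib.comp (u := f) ⟨(hmi i).aemeasurable, (hmi 0).aemeasurable, by rw [hmap i, hmap 0]⟩
        hfc.measurable
    have hint : Integrable (fun g : ℕ → EuclideanSpace ℝ V =>
        f (gaussianNode A σb σw S (g 0))) (layerNoise V) := by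
      have := integrable_relu_mul_relu (convCov A σb σw S.1) x x'
      rw [← hmap 0] at this
      exact this.comp_measurable (hmi 0)
    have hlim : ∫ g, f (gaussianNode A σb σw S (g 0)) ∂(layerNoise V) =
        (limitGram A σb σw S).1 x x' := by
      change _ = ∫ z, f z ∂_
      rw [← hmap 0, integral_map (hmi 0).aemeasurable hfc.aestronglyMeasurable]
    filter_upwards [strong_law_ae_real _ hint (fun i j hij => hind.indepFun hij) hident] with g hg
    rw [hlim] at hg
    refine hg.congr fun m => ?_
    rw [sampleGram, reluGram, featureGram_apply, Finset.sum_range]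
    rfl
  have := ae_all_iff.2 fun x => ae_all_iff.2 (key x)
  filter_upwards [this] with g hg
  rw [tendsto_subtype_rng]
  exact tendsto_pi_nhds.2 fun x => tendsto_pi_nhds.2 fun x' => hg x x'

end GaussianLayer

/-! ### Independence of the past, and comparison of chains -/

section Comparison

/-- A random variable that is a function of the `θ i`, `i ∈ s`, is independent of `θ k`, `k ∉ s`. -/
lemma indepFun_of_measurable_iSup {Ω ι γ : Type*} {mΩ : MeasurableSpace Ω} {mγ : MeasurableSpace γ}
    {P : Measure Ω} {β : ι → Type*} {mβ : ∀ i, MeasurableSpace (β i)} {θ : ∀ i, Ω → β i}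
    (hθ : iIndepFun θ P) (hm : ∀ i, Measurable (θ i)) {s : Set ι} {k : ι} (hk : k ∉ s)
    {X : Ω → γ} (hX : Measurable[⨆ i ∈ s, (mβ i).comap (θ i)] X) : IndepFun X (θ k) P := by
  have h := indep_iSup_of_disjoint (fun i => (hm i).comap_le) hθ.iIndep
    (Set.disjoint_singleton_right.2 hk)
  rw [iSup_singleton] at h
  exact indep_of_indep_of_le_left h hX.comap_le

lemma iSup_comap_le {Ω ι : Type*} {mΩ : MeasurableSpace Ω} {β : ι → Type*}
    {mβ : ∀ i, MeasurableSpace (β i)} {θ : ∀ i, Ω → β i} (hm : ∀ i, Measurable (θ i))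
    (s : Set ι) : (⨆ i ∈ s, (mβ i).comap (θ i)) ≤ mΩ :=
  iSup₂_le fun i _ => (hm i).comap_le

/-- Comparison of one step of two chains: if the law of `f x Y` depends on `x` only through `p x` and
is then the law of `f' (p x) Y'`, a step from `X` has the same law as a step from a variable `S`
distributed like `p X`. -/
lemma map_eq_map_of_indepFun {Ω Ω' α β σ β' γ : Type*} {mΩ : MeasurableSpace Ω}
    {mΩ' : MeasurableSpace Ω'} {mα : MeasurableSpace α} {mβ : MeasurableSpace β}
    {mσ : MeasurableSpace σ} {mβ' : MeasurableSpace β'} {mγ : MeasurableSpace γ}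
    {P : Measure Ω} {P' : Measure Ω'} [IsProbabilityMeasure P] [IsProbabilityMeasure P']
    {X : Ω → α} {Y : Ω → β} {S : Ω' → σ} {Y' : Ω' → β'} {f : α → β → γ} {f' : σ → β' → γ}
    {p : α → σ} (hX : Measurable X) (hY : Measurable Y) (hS : Measurable S) (hY' : Measurable Y')
    (hf : Measurable fun q : α × β => f q.1 q.2) (hf' : Measurable fun q : σ × β' => f' q.1 q.2)
    (hp : Measurable p) (hXY : IndepFun X Y P) (hSY : IndepFun S Y' P')
    (hlaw : P.map (fun ω => p (X ω)) = P'.map S)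
    (hker : ∀ x, (P.map Y).map (f x) = (P'.map Y').map (f' (p x))) :
    P.map (fun ω => f (X ω) (Y ω)) = P'.map (fun ω => f' (S ω) (Y' ω)) := by
  have h1 := (indepFun_iff_map_prod_eq_prod_map_map hX.aemeasurable hY.aemeasurable).1 hXY
  have h2 := (indepFun_iff_map_prod_eq_prod_map_map hS.aemeasurable hY'.aemeasurable).1 hSY
  have := Measure.isProbabilityMeasure_map (μ := P) hY.aemeasurable
  have := Measure.isProbabilityMeasure_map (μ := P') hY'.aemeasurable
  have e1 : P.map (fun ω => f (X ω) (Y ω)) = ((P.map X).prod (P.map Y)).map fun q => f q.1 q.2 := by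
    rw [← h1, Measure.map_map hf (hX.prodMk hY)]; rfl
  have e2 : P'.map (fun ω => f' (S ω) (Y' ω)) =
      ((P'.map S).prod (P'.map Y')).map fun q => f' q.1 q.2 := by
    rw [← h2, Measure.map_map hf' (hS.prodMk hY')]; rfl
  rw [e1, e2]
  ext s hs
  rw [Measure.map_apply hf hs, Measure.map_apply hf' hs, Measure.prod_apply (hf hs),
    Measure.prod_apply (hf' hs), ← hlaw, lintegral_map (measurable_measure_prodMk_left (hf' hs))
    (show Measurable fun ω => p (X ω) from hp.comp hX),
    lintegral_map (measurable_measure_prodMk_left (hf hs)) hX]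
  refine lintegral_congr fun ω => ?_
  have hm : Measurable (f (X ω)) := hf.comp measurable_prodMk_left
  have hm' : Measurable (f' (p (X ω))) := hf'.comp measurable_prodMk_left
  have h := congrArg (fun μ : Measure γ => μ s) (hker (X ω))
  simp only [Measure.map_apply hm hs, Measure.map_apply hm' hs] at h
  exact h

end Comparison

/-! ### The chain of Gram matrices and its successive limits -/

section GramChain

variable {V : Type*} [Fintype V] [DecidableEq V]

/-- The deterministic Gram matrices of the infinitely wide network, i.e. the matrices `C^{(j)}`. -/
def limitChain (A : Matrix V V ℝ) (σb σw : ℝ≥0) (S₀ : PSDMatrix V) : ℕ → PSDMatrix V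
  | 0 => S₀
  | j + 1 => limitGram A σb σw (limitChain A σb σw S₀ j)

/-- The Gram matrices of a network in which the layers `1, …, k` are infinitely wide and each
later layer `j` has `d j` Gaussian neurons, driven by the noise `g`; the input has Gram matrix `S₀`. -/
def gramChain (A : Matrix V V ℝ) (σb σw : ℝ≥0) (S₀ : PSDMatrix V) (d : ℕ → ℕ) (k : ℕ)
    (g : ℕ → ℕ → EuclideanSpace ℝ V) : ℕ → PSDMatrix V
  | 0 => S₀
  | j + 1 => if j < k then limitGram A σb σw (gramChain A σb σw S₀ d k g j)
      else sampleGram A σb σw (d (j + 1)) (gramChain A σb σw S₀ d k g j) (g j)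

/-- The noise driving a whole network: independent noise for each layer. -/
def networkNoise (V : Type*) [Fintype V] : Measure (ℕ → ℕ → EuclideanSpace ℝ V) :=
  Measure.infinitePi fun _ => layerNoise V

instance instIsProbabilityMeasureNetworkNoise {V : Type*} [Fintype V] :
    IsProbabilityMeasure (networkNoise V) := by
  unfold networkNoise; infer_instance

lemma measurePreserving_eval_networkNoise {V : Type*} [Fintype V] (j : ℕ) :
    MeasurePreserving (fun g : ℕ → ℕ → EuclideanSpace ℝ V => g j) (networkNoise V)
      (layerNoise V) :=
  measurePreserving_eval_infinitePi (fun _ : ℕ => layerNoise V) j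

/-- In the infinitely wide layers the chain is deterministic. -/
lemma gramChain_eq_limitChain (A : Matrix V V ℝ) (σb σw : ℝ≥0) (S₀ : PSDMatrix V) (d : ℕ → ℕ)
    {k : ℕ} (g : ℕ → ℕ → EuclideanSpace ℝ V) {j : ℕ} (hj : j ≤ k) :
    gramChain A σb σw S₀ d k g j = limitChain A σb σw S₀ j := by
  induction j with
  | zero => rfl
  | succ j ih => rw [gramChain, if_pos (Nat.lt_of_succ_le hj), ih (by omega), limitChain]

lemma gramChain_succ_of_le (A : Matrix V V ℝ) (σb σw : ℝ≥0) (S₀ : PSDMatrix V) (d : ℕ → ℕ)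
    {k : ℕ} (g : ℕ → ℕ → EuclideanSpace ℝ V) {j : ℕ} (hj : k ≤ j) :
    gramChain A σb σw S₀ d k g (j + 1) =
      sampleGram A σb σw (d (j + 1)) (gramChain A σb σw S₀ d k g j) (g j) := by
  rw [gramChain, if_neg hj.not_gt]

/-- The Gram matrix entering layer `j + 1` depends on the noise of the earlier layers only. -/
lemma measurable_gramChain_past (A : Matrix V V ℝ) (σb σw : ℝ≥0) (S₀ : PSDMatrix V) (d : ℕ → ℕ)
    (k j : ℕ) :
    Measurable[⨆ i ∈ Set.Iio j, MeasurableSpace.comap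
      (fun g : ℕ → ℕ → EuclideanSpace ℝ V => g i) inferInstance]
      fun g => gramChain A σb σw S₀ d k g j := by
  induction j with
  | zero => exact measurable_const
  | succ j ih =>
    rcases lt_or_ge j k with h | h
    · simp_rw [gramChain_eq_limitChain A σb σw S₀ d _ (Nat.succ_le_of_lt h)]
      exact measurable_const
    · simp_rw [gramChain_succ_of_le A σb σw S₀ d _ h]
      have h1 := ih.mono (biSup_mono (f := fun i : ℕ => MeasurableSpace.comap
        (fun g : ℕ → ℕ → EuclideanSpace ℝ V => g i) inferInstance)
        fun i (hi : i ∈ Set.Iio j) => Set.Iio_subset_Iio j.le_succ hi) le_rfl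
      have h2 := (comap_measurable (fun g : ℕ → ℕ → EuclideanSpace ℝ V => g j)).mono
        (le_biSup (fun i : ℕ => MeasurableSpace.comap
          (fun g : ℕ → ℕ → EuclideanSpace ℝ V => g i) inferInstance)
          (Set.mem_Iio.2 j.lt_succ_self)) le_rfl
      exact measurable_sampleGram A σb σw (d (j + 1)) h1 h2

lemma measurable_gramChain (A : Matrix V V ℝ) (σb σw : ℝ≥0) (S₀ : PSDMatrix V) (d : ℕ → ℕ)
    (k j : ℕ) : Measurable fun g => gramChain A σb σw S₀ d k g j :=
  (measurable_gramChain_past A σb σw S₀ d k j).mono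
    (iSup_comap_le (fun i => measurable_pi_apply i) _) le_rfl

lemma indepFun_gramChain (A : Matrix V V ℝ) (σb σw : ℝ≥0) (S₀ : PSDMatrix V) (d : ℕ → ℕ)
    (k j : ℕ) : IndepFun (fun g => gramChain A σb σw S₀ d k g j)
      (fun g : ℕ → ℕ → EuclideanSpace ℝ V => g j) (networkNoise V) := by
  have h : iIndepFun (fun (i : ℕ) (g : ℕ → ℕ → EuclideanSpace ℝ V) => g i) (networkNoise V) :=
    iIndepFun_infinitePi (P := fun _ : ℕ => layerNoise V) (X := fun _ => id)
      fun _ => measurable_id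
  exact indepFun_of_measurable_iSup h (fun i => measurable_pi_apply i) Set.self_notMem_Iio
    (measurable_gramChain_past A σb σw S₀ d k j)

/-- Letting the width of the first finite layer tend to infinity: that layer converges by the law of
large numbers, and the later ones follow because they depend continuously on it for fixed noise. -/
lemma ae_tendsto_gramChain_update (A : Matrix V V ℝ) (σb σw : ℝ≥0) (S₀ : PSDMatrix V)
    (d : ℕ → ℕ) (k : ℕ) : ∀ᵐ g ∂(networkNoise V), ∀ j,
      Tendsto (fun m => gramChain A σb σw S₀ (Function.update d (k + 1) m) k g j) atTop
        (𝓝 (gramChain A σb σw S₀ d (k + 1) g j)) := by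
  filter_upwards [(measurePreserving_eval_networkNoise k).quasiMeasurePreserving.ae
    (ae_tendsto_sampleGram A σb σw (limitChain A σb σw S₀ k))] with g hg j
  induction j with
  | zero => exact tendsto_const_nhds
  | succ j ih =>
    rcases lt_trichotomy j k with h | rfl | h
    · simp_rw [gramChain_eq_limitChain A σb σw S₀ _ g (Nat.succ_le_of_lt h),
        gramChain_eq_limitChain A σb σw S₀ d g (Nat.succ_le_succ h.le)]
      exact tendsto_const_nhds
    · rw [gramChain_eq_limitChain A σb σw S₀ d g le_rfl, limitChain]
      have e : ∀ d', gramChain A σb σw S₀ d' j g (j + 1) =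
          sampleGram A σb σw (d' (j + 1)) (limitChain A σb σw S₀ j) (g j) := fun d' => by
        rw [gramChain_succ_of_le A σb σw S₀ d' g le_rfl,
          gramChain_eq_limitChain A σb σw S₀ d' g le_rfl]
      simp_rw [e, Function.update_self]
      exact hg
    · have h3 : j + 1 ≠ k + 1 := by omega
      have e : ∀ d', gramChain A σb σw S₀ d' k g (j + 1) =
          sampleGram A σb σw (d' (j + 1)) (gramChain A σb σw S₀ d' k g j) (g j) :=
        fun d' => gramChain_succ_of_le A σb σw S₀ d' g h.le
      rw [gramChain_succ_of_le A σb σw S₀ d g (Nat.succ_le_of_lt h)]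
      simp_rw [e, Function.update_of_ne h3]
      have hc := (continuous_sampleGram A σb σw (d (j + 1))).comp
        (Continuous.prodMk_left (g j))
      exact hc.continuousAt.tendsto.comp ih

lemma measurable_gaussianNode_gramChain (A : Matrix V V ℝ) (σb σw : ℝ≥0) (S₀ : PSDMatrix V)
    (d : ℕ → ℕ) (k l i : ℕ) :
    Measurable fun g => gaussianNode A σb σw (gramChain A σb σw S₀ d k g l) (g l i) := by
  have h1 : Measurable fun g : ℕ → ℕ → EuclideanSpace ℝ V => g l i := by fun_prop
  have h := (continuous_gaussianNode A σb σw).measurable.comp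
    ((measurable_gramChain A σb σw S₀ d k l).prodMk h1)
  exact h

/-- The law of the pre-activation of neuron `i` in layer `l + 1` of a network whose layers `1, …, k`
are infinitely wide. -/
def partialLimitLaw (A : Matrix V V ℝ) (σb σw : ℝ≥0) (S₀ : PSDMatrix V) (l i k : ℕ) (d : ℕ → ℕ) :
    ProbabilityMeasure (EuclideanSpace ℝ V) :=
  ⟨(networkNoise V).map fun g => gaussianNode A σb σw (gramChain A σb σw S₀ d k g l) (g l i),
    Measure.isProbabilityMeasure_map
      (measurable_gaussianNode_gramChain A σb σw S₀ d k l i).aemeasurable⟩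

lemma tendsto_partialLimitLaw (A : Matrix V V ℝ) (σb σw : ℝ≥0) (S₀ : PSDMatrix V) (l i k : ℕ)
    (d : ℕ → ℕ) :
    Tendsto (fun m => partialLimitLaw A σb σw S₀ l i k (Function.update d (k + 1) m)) atTop
      (𝓝 (partialLimitLaw A σb σw S₀ l i (k + 1) d)) := by
  have hm := fun d k => measurable_gaussianNode_gramChain A σb σw S₀ d k l i
  refine ((tendstoInMeasure_of_tendsto_ae (μ := networkNoise V)
    (f := fun m g => gaussianNode A σb σw
      (gramChain A σb σw S₀ (Function.update d (k + 1) m) k g l) (g l i))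
    (g := fun g => gaussianNode A σb σw (gramChain A σb σw S₀ d (k + 1) g l) (g l i))
    (fun m => (hm _ _).aestronglyMeasurable) ?_).tendstoInDistribution
    fun m => (hm _ _).aemeasurable).tendsto
  filter_upwards [ae_tendsto_gramChain_update A σb σw S₀ d k] with g hg
  have h := ((continuous_gaussianNode A σb σw).comp
    (Continuous.prodMk_left (g l i))).continuousAt.tendsto.comp (hg l)
  exact h

/-- Once all layers before layer `l + 1` are infinitely wide, the law is exactly Gaussian. -/
lemma partialLimitLaw_of_le (A : Matrix V V ℝ) (σb σw : ℝ≥0) (S₀ : PSDMatrix V) {l k : ℕ}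
    (hlk : l ≤ k) (i : ℕ) (d : ℕ → ℕ) :
    (partialLimitLaw A σb σw S₀ l i k d : Measure (EuclideanSpace ℝ V)) =
      multivariateGaussian 0 (convCov A σb σw (limitChain A σb σw S₀ l).1) := by
  have hm : Measurable fun g : ℕ → EuclideanSpace ℝ V =>
      gaussianNode A σb σw (limitChain A σb σw S₀ l) (g i) :=
    (measurable_gaussianNode A σb σw _).comp (measurable_pi_apply i)
  rw [← map_gaussianNode_eval A σb σw (limitChain A σb σw S₀ l) i,
    ← (measurePreserving_eval_networkNoise l).map_eq, Measure.map_map hm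
      (measurePreserving_eval_networkNoise l).measurable]
  simp only [partialLimitLaw, ProbabilityMeasure.coe_mk,
    gramChain_eq_limitChain A σb σw S₀ d _ hlk]
  rfl

end GramChain

/-! ### The law of the parameters -/

section ParamLaw

/-- The parameters of layer `l + 1`: weights and biases. -/
abbrev LayerParam (d₀ : ℕ) (d : ℕ → ℕ) (l : ℕ) : Type :=
  (Fin (layerWidth d₀ d l) × Fin (layerWidth d₀ d (l + 1))) ⊕ Fin (layerWidth d₀ d (l + 1)) → ℝ

/-- The law of a single parameter of a layer with `m` inputs and `n` outputs. -/
def entryLaw (σb σw : ℝ≥0) (m n : ℕ) : (Fin m × Fin n) ⊕ Fin n → Measure ℝ :=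
  Sum.elim (fun _ => gaussianReal 0 (σw ^ 2 / (m : ℝ≥0))) (fun _ => gaussianReal 0 (σb ^ 2))

instance instIsProbabilityMeasureEntryLaw (σb σw : ℝ≥0) (m n : ℕ) (p : (Fin m × Fin n) ⊕ Fin n) :
    IsProbabilityMeasure (entryLaw σb σw m n p) := by
  rcases p with p | p <;> simp only [entryLaw, Sum.elim_inl, Sum.elim_inr] <;> infer_instance

/-- The joint law of the parameters of the layers `1, …, L`, grouped by layer. -/
def paramLaw (σb σw : ℝ≥0) (d₀ : ℕ) (d : ℕ → ℕ) (L : ℕ) :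
    Measure (∀ l : Fin L, LayerParam d₀ d l) :=
  Measure.infinitePi fun l : Fin L =>
    Measure.pi (entryLaw σb σw (layerWidth d₀ d l) (layerWidth d₀ d (l + 1)))

instance instIsProbabilityMeasureParamLaw (σb σw : ℝ≥0) (d₀ : ℕ) (d : ℕ → ℕ) (L : ℕ) :
    IsProbabilityMeasure (paramLaw σb σw d₀ d L) := by
  unfold paramLaw; infer_instance

/-- The parameters of a random network, grouped by layer, are distributed as `paramLaw`. -/
lemma IsGCNPrior.hasLaw_params {Ω : Type*} [MeasurableSpace Ω] {P : Measure Ω}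
    [IsProbabilityMeasure P] {d₀ : ℕ} {d : ℕ → ℕ} {L : ℕ} {σb σw : ℝ≥0}
    {W : Ω → ∀ l : ℕ, Matrix (Fin (layerWidth d₀ d l)) (Fin (layerWidth d₀ d (l + 1))) ℝ}
    {b : Ω → ∀ l : ℕ, Fin (layerWidth d₀ d (l + 1)) → ℝ} (h : IsGCNPrior P d₀ d L σb σw W b) :
    HasLaw (fun ω (l : Fin L) =>
      (Sum.elim (fun e => W ω l e.1 e.2) (fun i => b ω l i) : LayerParam d₀ d l))
      (paramLaw σb σw d₀ d L) P := by
  -- the independent parameters have a product law over layers and entries, which is then curried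
  have hlaw : ∀ q : GCNParamIndex d₀ d L, HasLaw
      (fun ω => Sum.elim (fun e => W ω q.1 e.1 e.2) (fun i => b ω q.1 i) q.2)
      (entryLaw σb σw (layerWidth d₀ d q.1) (layerWidth d₀ d (q.1 + 1)) q.2) P := by
    rintro ⟨l, e | i⟩
    · exact h.law_weight l l.2 e.1 e.2
    · exact h.law_bias l l.2 i
  have hm := fun q => (hlaw q).aemeasurable
  have h1 := (iIndepFun_iff_map_fun_eq_pi_map hm).1 h.indep
  simp_rw [fun q => (hlaw q).map_eq] at h1
  have h2 := Measure.infinitePi_map_piCurry (X := fun (l : Fin L)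
    (_ : (Fin (layerWidth d₀ d l) × Fin (layerWidth d₀ d (l + 1))) ⊕
      Fin (layerWidth d₀ d (l + 1))) => ℝ)
    (fun l : Fin L => entryLaw σb σw (layerWidth d₀ d l) (layerWidth d₀ d (l + 1)))
  refine ⟨by
    refine aemeasurable_pi_lambda _ fun l => aemeasurable_pi_lambda _ fun p => hm ⟨l, p⟩, ?_⟩
  rw [paramLaw]
  simp_rw [← Measure.infinitePi_eq_pi] at h1 ⊢
  rw [← h2, ← h1, AEMeasurable.map_map_of_aemeasurable
    (MeasurableEquiv.measurable _).aemeasurable (aemeasurable_pi_lambda _ hm)]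
  rfl

end ParamLaw

/-! ### The random network and the chain -/

section Network

variable {d₀ : ℕ} {d : ℕ → ℕ} {L : ℕ}

/-- The weight matrices of a parameter vector, extended by `0` beyond layer `L`. -/
def paramWeight (θ : ∀ l : Fin L, LayerParam d₀ d l) (l : ℕ) :
    Matrix (Fin (layerWidth d₀ d l)) (Fin (layerWidth d₀ d (l + 1))) ℝ :=
  if h : l < L then Matrix.of fun j i => θ ⟨l, h⟩ (.inl (j, i)) else 0

/-- The biases of a parameter vector, extended by `0` beyond layer `L`. -/
def paramBias (θ : ∀ l : Fin L, LayerParam d₀ d l) (l : ℕ) :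
    Fin (layerWidth d₀ d (l + 1)) → ℝ :=
  if h : l < L then fun i => θ ⟨l, h⟩ (.inr i) else 0

variable {V : Type*} [Fintype V]

lemma gcnPost_congr (A : Matrix V V ℝ) (X₀ : Matrix V (Fin d₀) ℝ)
    {W W' : ∀ l : ℕ, Matrix (Fin (layerWidth d₀ d l)) (Fin (layerWidth d₀ d (l + 1))) ℝ}
    {b b' : ∀ l : ℕ, Fin (layerWidth d₀ d (l + 1)) → ℝ} {l : ℕ}
    (hW : ∀ k < l, W k = W' k) (hb : ∀ k < l, b k = b' k) :
    gcnPost A X₀ W b l = gcnPost A X₀ W' b' l := by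
  induction l with
  | zero => rfl
  | succ l ih =>
    rw [gcnPost, gcnPost, ih (fun k hk => hW k (by omega)) (fun k hk => hb k (by omega)),
      hW l (by omega), hb l (by omega)]

/-- The post-activations as a function of the parameter vector. -/
def paramPost (A : Matrix V V ℝ) (X₀ : Matrix V (Fin d₀) ℝ) (l : ℕ)
    (θ : ∀ l : Fin L, LayerParam d₀ d l) : Matrix V (Fin (layerWidth d₀ d l)) ℝ :=
  gcnPost A X₀ (paramWeight θ) (paramBias θ) l

lemma paramPost_succ (A : Matrix V V ℝ) (X₀ : Matrix V (Fin d₀) ℝ) {l : ℕ} (hl : l < L)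
    (θ : ∀ l : Fin L, LayerParam d₀ d l) : paramPost A X₀ (l + 1) θ =
      Matrix.of fun x i => relu (convLinear A (paramPost A X₀ l θ) (θ ⟨l, hl⟩) i x) := by
  rw [paramPost, gcnPost, paramWeight, paramBias, dif_pos hl, dif_pos hl]
  rfl

lemma measurable_convLinear {m n : ℕ} (A : Matrix V V ℝ) :
    Measurable fun q : Matrix V (Fin m) ℝ × ((Fin m × Fin n) ⊕ Fin n → ℝ) =>
      convLinear A q.1 q.2 := by
  have h : Continuous fun q : Matrix V (Fin m) ℝ × ((Fin m × Fin n) ⊕ Fin n → ℝ) =>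
      convLinear A q.1 q.2 := by
    refine continuous_pi fun i => (PiLp.continuous_toLp 2 _).comp (continuous_pi fun x => ?_)
    simp only [graphConv, Matrix.of_apply]
    have hX : ∀ v j, Continuous fun q : Matrix V (Fin m) ℝ × ((Fin m × Fin n) ⊕ Fin n → ℝ) =>
      q.1 v j := fun v j => continuous_fst.matrix_elem v j
    fun_prop
  exact h.measurable

/-- The post-activations of layer `l` depend on the parameters of the layers `1, …, l` only. -/
lemma measurable_paramPost_past (A : Matrix V V ℝ) (X₀ : Matrix V (Fin d₀) ℝ) {l : ℕ}
    (hl : l ≤ L) :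
    Measurable[⨆ i ∈ {i : Fin L | (i : ℕ) < l}, MeasurableSpace.comap
      (fun θ : ∀ l : Fin L, LayerParam d₀ d l => θ i) inferInstance] (paramPost A X₀ l) := by
  induction l with
  | zero => exact measurable_const
  | succ l ih =>
    have h1 := (ih (by omega)).mono (biSup_mono (f := fun i : Fin L => MeasurableSpace.comap
      (fun θ : ∀ l : Fin L, LayerParam d₀ d l => θ i) inferInstance)
      (q := fun i => i ∈ {i : Fin L | (i : ℕ) < l + 1})
      fun i (hi : (i : ℕ) < l) => (hi.trans l.lt_succ_self : (i : ℕ) < l + 1)) le_rfl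
    have h2 := (comap_measurable
      (fun θ : ∀ l : Fin L, LayerParam d₀ d l => θ ⟨l, hl⟩)).mono
      (le_biSup (fun i : Fin L => MeasurableSpace.comap
        (fun θ : ∀ l : Fin L, LayerParam d₀ d l => θ i) inferInstance)
        (show (⟨l, hl⟩ : Fin L) ∈ {i : Fin L | (i : ℕ) < l + 1} from l.lt_succ_self)) le_rfl
    have h3 : Measurable fun z : Fin (layerWidth d₀ d (l + 1)) → EuclideanSpace ℝ V =>
        (Matrix.of fun x i => relu (z i x)) := by
      refine (continuous_matrix fun x i => ?_).measurable
      exact continuous_relu.comp (by fun_prop)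
    have h4 := h3.comp ((measurable_convLinear A).comp (h1.prodMk h2))
    rw [show paramPost A X₀ (l + 1) = _ from funext fun θ => paramPost_succ A X₀ hl θ]
    exact h4

lemma measurable_paramPost (A : Matrix V V ℝ) (X₀ : Matrix V (Fin d₀) ℝ) {l : ℕ}
    (hl : l ≤ L) :
    Measurable fun θ : ∀ l : Fin L, LayerParam d₀ d l => paramPost A X₀ l θ :=
  (measurable_paramPost_past A X₀ hl).mono
    (iSup_comap_le (fun i => measurable_pi_apply i) _) le_rfl

lemma indepFun_paramPost (A : Matrix V V ℝ) (X₀ : Matrix V (Fin d₀) ℝ) (σb σw : ℝ≥0) {l : ℕ}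
    (hl : l < L) : IndepFun (fun θ : ∀ l : Fin L, LayerParam d₀ d l => paramPost A X₀ l θ)
      (fun θ => θ ⟨l, hl⟩) (paramLaw σb σw d₀ d L) := by
  have h : iIndepFun (fun (i : Fin L) (θ : ∀ l : Fin L, LayerParam d₀ d l) => θ i)
      (paramLaw σb σw d₀ d L) :=
    iIndepFun_infinitePi (X := fun _ => id) fun _ => measurable_id
  exact indepFun_of_measurable_iSup h (fun i => measurable_pi_apply i)
    (k := ⟨l, hl⟩) (fun h => lt_irrefl l h) (measurable_paramPost_past A X₀ hl.le)

lemma measurable_convLinear_paramPost (A : Matrix V V ℝ) (X₀ : Matrix V (Fin d₀) ℝ) {l : ℕ}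
    (hl : l < L) : Measurable fun θ : ∀ l : Fin L, LayerParam d₀ d l =>
      convLinear A (paramPost A X₀ l θ) (θ ⟨l, hl⟩) := by
  have h := (measurable_convLinear A).comp ((measurable_paramPost A X₀ (d := d)
    hl.le).prodMk (measurable_pi_apply (⟨l, hl⟩ : Fin L)))
  exact h

variable [DecidableEq V]

lemma measurable_gaussianLayer (A : Matrix V V ℝ) (σb σw : ℝ≥0) (n : ℕ) :
    Measurable fun p : PSDMatrix V × (ℕ → EuclideanSpace ℝ V) =>
      gaussianLayer A σb σw n p.1 p.2 :=
  (continuous_gaussianLayer A σb σw n).measurable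

lemma measurable_gaussianLayer_gramChain (A : Matrix V V ℝ) (σb σw : ℝ≥0) (S₀ : PSDMatrix V)
    (d : ℕ → ℕ) (n l : ℕ) : Measurable fun g : ℕ → ℕ → EuclideanSpace ℝ V =>
      gaussianLayer A σb σw n (gramChain A σb σw S₀ d 0 g l) (g l) := by
  have h := (measurable_gaussianLayer A σb σw n).comp
    ((measurable_gramChain A σb σw S₀ d 0 l).prodMk (measurable_pi_apply l))
  exact h

/-- If the Gram matrices entering layer `l + 1` agree in law between the network and the chain, so do
the pre-activations of that layer. -/
lemma map_convLinear_paramPost_of_map_featureGram (A : Matrix V V ℝ) (X₀ : Matrix V (Fin d₀) ℝ)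
    (σb σw : ℝ≥0) {l : ℕ} (hl : l < L)
    (hlaw : (paramLaw σb σw d₀ d L).map (fun θ => featureGram (paramPost A X₀ l θ)) =
      (networkNoise V).map fun g => gramChain A σb σw (featureGram X₀) d 0 g l) :
    (paramLaw σb σw d₀ d L).map
      (fun θ => convLinear A (paramPost A X₀ l θ) (θ ⟨l, hl⟩)) =
    (networkNoise V).map fun g => gaussianLayer A σb σw (layerWidth d₀ d (l + 1))
      (gramChain A σb σw (featureGram X₀) d 0 g l) (g l) := by
  have hθ : (paramLaw σb σw d₀ d L).map (fun θ => θ ⟨l, hl⟩) =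
      Measure.pi (entryLaw σb σw (layerWidth d₀ d l) (layerWidth d₀ d (l + 1))) :=
    (measurePreserving_eval_infinitePi (fun l : Fin L =>
      Measure.pi (entryLaw σb σw (layerWidth d₀ d l) (layerWidth d₀ d (l + 1)))) ⟨l, hl⟩).map_eq
  refine map_eq_map_of_indepFun (measurable_paramPost A X₀ hl.le) (measurable_pi_apply _)
    (measurable_gramChain A σb σw (featureGram X₀) d 0 l) (measurable_pi_apply _)
    (f := fun X θ => convLinear A X θ)
    (f' := fun S g => gaussianLayer A σb σw (layerWidth d₀ d (l + 1)) S g)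
    (measurable_convLinear A) (measurable_gaussianLayer A σb σw (layerWidth d₀ d (l + 1)))
    continuous_featureGram.measurable (indepFun_paramPost A X₀ σb σw hl)
    (indepFun_gramChain A σb σw (featureGram X₀) d 0 l) hlaw fun X => ?_
  erw [hθ, (measurePreserving_eval_networkNoise l).map_eq]
  exact (map_convLinear_pi_gaussianReal A σb σw X).trans
    (map_gaussianLayer A σb σw (layerWidth d₀ d (l + 1)) (featureGram X)).symm

/-- The Gram matrices of the random network form the Markov chain `gramChain` with no infinitely wide
layer, in the sense of one-dimensional marginals. -/
lemma map_featureGram_paramPost (A : Matrix V V ℝ) (X₀ : Matrix V (Fin d₀) ℝ) (σb σw : ℝ≥0)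
    {l : ℕ} (hl : l ≤ L) :
    (paramLaw σb σw d₀ d L).map (fun θ => featureGram (paramPost A X₀ l θ)) =
      (networkNoise V).map fun g => gramChain A σb σw (featureGram X₀) d 0 g l := by
  induction l with
  | zero =>
    have h1 : (fun θ : ∀ l : Fin L, LayerParam d₀ d l => featureGram (paramPost A X₀ 0 θ)) =
      fun _ => featureGram X₀ := rfl
    have h2 : (fun g : ℕ → ℕ → EuclideanSpace ℝ V =>
      gramChain A σb σw (featureGram X₀) d 0 g 0) = fun _ => featureGram X₀ := rfl
    rw [h1, h2, Measure.map_const, Measure.map_const, measure_univ, measure_univ]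
  | succ l ih =>
    have h := congrArg (fun μ => μ.map reluGram)
      (map_convLinear_paramPost_of_map_featureGram A X₀ σb σw hl (ih (by omega)))
    have hm : Measurable
        (reluGram : (Fin (layerWidth d₀ d (l + 1)) → EuclideanSpace ℝ V) → PSDMatrix V) :=
      continuous_reluGram.measurable
    have hm1 := measurable_convLinear_paramPost (d := d) A X₀ hl
    have hm2 := measurable_gaussianLayer_gramChain A σb σw (featureGram X₀) d
      (layerWidth d₀ d (l + 1)) l
    simp only at h
    rw [Measure.map_map hm hm2, Measure.map_map hm hm1] at h
    rw [show (fun θ : ∀ l : Fin L, LayerParam d₀ d l => featureGram (paramPost A X₀ (l + 1) θ)) = _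
      from funext fun θ => congrArg featureGram (paramPost_succ A X₀ hl θ)]
    rw [show (fun g => gramChain A σb σw (featureGram X₀) d 0 g (l + 1)) = _
      from funext fun g => gramChain_succ_of_le A σb σw (featureGram X₀) d g l.zero_le]
    exact h

/-- The finite-width network has the law from which the successive limits start. -/
lemma IsGCNPrior.map_gcnPre {Ω : Type*} [MeasurableSpace Ω] {P : Measure Ω}
    [IsProbabilityMeasure P] {σb σw : ℝ≥0}
    {W : Ω → ∀ l : ℕ, Matrix (Fin (layerWidth d₀ d l)) (Fin (layerWidth d₀ d (l + 1))) ℝ}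
    {b : Ω → ∀ l : ℕ, Fin (layerWidth d₀ d (l + 1)) → ℝ} (h : IsGCNPrior P d₀ d L σb σw W b)
    (A : Matrix V V ℝ) (X₀ : Matrix V (Fin d₀) ℝ) {l : ℕ} (hl : l < L) {i : ℕ}
    (hi : i < d (l + 1)) :
    (P.map fun ω => WithLp.toLp 2 fun x => gcnPre A X₀ (W ω) (b ω) l x ⟨i, hi⟩) =
      (partialLimitLaw A σb σw (featureGram X₀) l i 0 d : Measure (EuclideanSpace ℝ V)) := by
  have hθ := h.hasLaw_params
  have hm1 := measurable_convLinear_paramPost (d := d) A X₀ hl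
  have hm2 := measurable_gaussianLayer_gramChain A σb σw (featureGram X₀) d
    (layerWidth d₀ d (l + 1)) l
  have hev : Measurable fun z : Fin (layerWidth d₀ d (l + 1)) → EuclideanSpace ℝ V => z ⟨i, hi⟩ :=
    measurable_pi_apply _
  have e1 : (fun ω => WithLp.toLp 2 fun x => gcnPre A X₀ (W ω) (b ω) l x ⟨i, hi⟩) =
      (fun θ : ∀ l : Fin L, LayerParam d₀ d l =>
        convLinear A (paramPost A X₀ l θ) (θ ⟨l, hl⟩) ⟨i, hi⟩) ∘ fun ω (l : Fin L) =>
      (Sum.elim (fun e => W ω l e.1 e.2) (fun i => b ω l i) : LayerParam d₀ d l) := by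
    funext ω
    ext x
    rw [gcnPre, gcnPost_congr A X₀
      (W' := paramWeight fun l : Fin L =>
        (Sum.elim (fun e => W ω l e.1 e.2) (fun i => b ω l i) : LayerParam d₀ d l))
      (b' := paramBias fun l : Fin L =>
        (Sum.elim (fun e => W ω l e.1 e.2) (fun i => b ω l i) : LayerParam d₀ d l))
      (fun k hk => by rw [paramWeight, dif_pos (hk.trans hl)]; rfl)
      (fun k hk => by rw [paramBias, dif_pos (hk.trans hl)]; rfl)]
    rfl
  have h1 := congrArg (fun μ : Measure (Fin (layerWidth d₀ d (l + 1)) → EuclideanSpace ℝ V) =>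
    μ.map fun z => z ⟨i, hi⟩) (map_convLinear_paramPost_of_map_featureGram A X₀ σb σw hl
      (map_featureGram_paramPost A X₀ σb σw hl.le))
  simp only at h1
  rw [Measure.map_map hev hm2] at h1
  rw [Measure.map_map hev hm1] at h1
  rw [e1, ← AEMeasurable.map_map_of_aemeasurable _ hθ.aemeasurable, hθ.map_eq]
  · exact h1
  · have := hev.comp hm1
    exact this.aemeasurable

end Network

end

theorem theorem1 {V : Type*} [Fintype V] [DecidableEq V] (A : Matrix V V ℝ)
    (L d₀ : ℕ) (X₀ : Matrix V (Fin d₀) ℝ) (σb σw : ℝ≥0)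
    -- for all positive widths `d 1, …, d L`: a random network of these widths
    (Ω : (ℕ → ℕ) → Type*) [∀ d, MeasurableSpace (Ω d)]
    (P : ∀ d, Measure (Ω d)) [∀ d, IsProbabilityMeasure (P d)]
    (W : ∀ d, Ω d → ∀ l : ℕ,
      Matrix (Fin (layerWidth d₀ d l)) (Fin (layerWidth d₀ d (l + 1))) ℝ)
    (b : ∀ d, Ω d → ∀ l : ℕ, Fin (layerWidth d₀ d (l + 1)) → ℝ)
    (hprior : ∀ d : ℕ → ℕ, (∀ k, 0 < d k) → IsGCNPrior (P d) d₀ d L σb σw (W d) (b d))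
    -- the matrices given by the recursion
    (C K : ℕ → Matrix V V ℝ)
    (hC₀ : ∀ x x', C 0 x x' = (∑ j, X₀ x j * X₀ x' j) / d₀)
    (hK : ∀ l < L, K (l + 1) =
      (σb : ℝ) ^ 2 • (Matrix.of fun _ _ => (1 : ℝ)) + (σw : ℝ) ^ 2 • (A * C l * A.transpose))
    (hC : ∀ l, 1 ≤ l → l ≤ L → ∀ x x', C l x x' =
      ∫ z : EuclideanSpace ℝ V, relu (z x) * relu (z x') ∂(multivariateGaussian 0 (K l))) :
    ∀ l < L, (K (l + 1)).PosSemidef ∧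
      ∀ i : ℕ, TendstoInSuccession {d : ℕ → ℕ | (∀ k, 0 < d k) ∧ i < d (l + 1)} (L - 1)
        (fun d hd => (P d).map fun ω =>
          WithLp.toLp 2 fun x => gcnPre A X₀ (W d ω) (b d ω) l x ⟨i, hd.2⟩)
        (multivariateGaussian 0 (K (l + 1))) := by
  have hCl : ∀ l ≤ L, C l = (limitChain A σb σw (featureGram X₀) l).1 := by
    intro l hl
    induction l with
    | zero =>
      ext x x'
      rw [hC₀, limitChain, featureGram_apply]
    | succ l ih =>
      ext x x'
      rw [hC (l + 1) l.succ_pos hl, hK l hl, ih (by omega)]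
      rfl
  have hKl : ∀ l < L, K (l + 1) = convCov A σb σw (limitChain A σb σw (featureGram X₀) l).1 :=
    fun l hl => by rw [hK l hl, hCl l hl.le, convCov]
  intro l hl
  refine ⟨hKl l hl ▸ posSemidef_convCov A σb σw (limitChain A σb σw (featureGram X₀) l).2,
    fun i => ⟨partialLimitLaw A σb σw (featureGram X₀) l i, fun d hd => ?_, fun k _ d _ => ?_,
      fun d _ => ?_⟩⟩
  · exact ((hprior d hd.1).map_gcnPre A X₀ hl hd.2).symm
  · exact tendsto_partialLimitLaw A σb σw (featureGram X₀) l i k d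
  · rw [hKl l hl]
    -- `l ≤ L - 1`: all layers feeding layer `l + 1` have been sent to infinite width
    exact partialLimitLaw_of_le A σb σw (featureGram X₀) (by omega) i d
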